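/- Let $\lambda,\mu>0$, $\rho=\lambda/\mu$, and let $K\ge 0$ be an integer. Let $\{Q(t)\}_{t\ge 0}$ be the queue length process of the stationary M/M/1/K queue with arrival rate $\lambda$, service rate $\mu$ and total capacity $K$; that is, $Q$ is a continuous-time Markov chain on $\{0,1,\dots,K\}$ with right-continuous paths having left limits, with transition rates $\lambda$ from $i$ to $i+1$ ($0\le i<K$) and $\mu$ from $i$ to $i-1$ ($0<i\le K$), such that the law of $Q(0)$ is the stationary distribution of the chain. Let $D(t)$ be the number of customers served in $(0,t]$, i.e. the number of downward jumps of $Q$ in $(0,t]$. Then $D(t)$ is integrable for every $t\ge 0$, and \[ \lim_{t\to\infty}\operatorname{Cov}\big(D(t),Q(t)\big)= \rho^{K+1}\left\{\frac{K^2(\rho-1)^2\left(1+3\rho^{K+1}\right)-2\rho\left(\rho^K-1\right)\left(-2+\rho+\rho^{K+2}\right)}{2(\rho-1)^2\left(\rho^{K+1}-1\right)^3}+\frac{K(\rho-1)\left(-1+3\rho-7\rho^{K+1}+5\rho^{K+2}\right)}{2(\rho-1)^2\left(\rho^{K+1}-1\right)^3}\right\} \] if $\rho\ne 1$, while \[ \lim_{t\to\infty}\operatorname{Cov}\big(D(t),Q(t)\big)=-\frac{K(K+2)}{24}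 \] if $\rho=1$. -/

import Mathlib

open MeasureTheory ProbabilityTheory Filter Topology
open scoped NNReal

/-- The generator matrix of the queue length of the M/M/1/K queue with arrival rate `lam` and
service rate `mu`, on the state space `{0, …, K}`: rate `lam` for `i → i + 1`, rate `mu` for
`i → i - 1`, and diagonal entries making every row sum vanish. -/
def mm1kGenerator (K : ℕ) (lam mu : ℝ) : Matrix (Fin (K + 1)) (Fin (K + 1)) ℝ :=
  Matrix.of fun i j =>
    if (j : ℕ) = (i : ℕ) + 1 then lam
    else if (i : ℕ) = (j : ℕ) + 1 then mu
    else if i = j then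
      -((if (i : ℕ) < K then lam else 0) + (if 0 < (i : ℕ) then mu else 0))
    else 0

/-- `X` is (under `P`) a continuous-time Markov chain on the finite state space `S` with generator
matrix `G` and with arbitrary initial law: its finite-dimensional distributions are those of the
Markov chain with transition matrices `exp (t G)`, and almost every path is a right-continuous
step function with left limits. -/
structure IsMarkovChainWithGenerator {Ω S : Type*} [MeasurableSpace Ω] [Fintype S] [DecidableEq S]
    (G : Matrix S S ℝ) (P : Measure Ω) (X : ℝ≥0 → Ω → S) : Prop where
  measurableSet_eq : ∀ (t : ℝ≥0) (i : S), MeasurableSet {ω | X t ω = i}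
  markov : ∀ (n : ℕ) (t : Fin (n + 1) → ℝ≥0) (i : Fin (n + 1) → S), Monotone t →
    P.real {ω | ∀ k, X (t k) ω = i k} =
      P.real {ω | X (t 0) ω = i 0} *
        ∏ k : Fin n,
          (NormedSpace.exp (((t k.succ : ℝ) - (t k.castSucc : ℝ)) • G) : Matrix S S ℝ)
            (i k.castSucc) (i k.succ)
  right_continuous : ∀ᵐ ω ∂P, ∀ t : ℝ≥0, ∀ᶠ s in 𝓝[>] t, X s ω = X t ω
  left_limits : ∀ᵐ ω ∂P, ∀ t : ℝ≥0, 0 < t → ∃ i : S, ∀ᶠ s in 𝓝[<] t, X s ω = i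

/-- `Q` is the queue length process of a stationary M/M/1/K queue: a Markov chain with the M/M/1/K
generator, whose initial law `θ` is a stationary distribution, `θ G = 0`. -/
structure IsStationaryMM1K {Ω : Type*} [MeasurableSpace Ω] (K : ℕ) (lam mu : ℝ) (P : Measure Ω)
    (Q : ℝ≥0 → Ω → Fin (K + 1)) : Prop where
  markovChain : IsMarkovChainWithGenerator (mm1kGenerator K lam mu) P Q
  stationary : Matrix.vecMul (fun i => P.real {ω | Q 0 ω = i}) (mm1kGenerator K lam mu) = 0

/-- The departure process `D(t)`: the number of served customers in `(0, t]`, that is, the number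
of times `s ∈ (0, t]` at which the queue length jumps down. (Downward jumps of the M/M/1/K queue
have size one almost surely, so each of them is the departure of one customer.) -/
noncomputable def departures {Ω : Type*} {K : ℕ} (Q : ℝ≥0 → Ω → Fin (K + 1)) (t : ℝ≥0) (ω : Ω) :
    ℕ :=
  Set.ncard {s : ℝ≥0 | 0 < s ∧ s ≤ t ∧ ∀ᶠ r in 𝓝[<] s, Q s ω < Q r ω}

/-!
Almost surely, `D(t)` is the limit of the number of descents of `Q` along the uniform grids of
`[0, t]` with mesh `t / n`. Write `P_t = exp (t G)`, let `θ` be the stationary law and `L` the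
strictly lower triangular part of `G`. In the expectation of the number of descents times
`(G w)(Q(t))`, replacing `G` by the difference quotient of the semigroup over one grid step makes
the sum over the grid telescope, and in the limit `E[D(t) (G w)(Q(t))] = θ L (P_t w - w)`. If `w`
solves the Poisson equation `G w = m - id`, this is `-Cov(D(t), Q(t))`, and detailed balance
reduces the right-hand side to a boundary term at the state `K`. A Poincaré inequality on
`{0, …, K}` gives `P_t w → θ w`, and `w` is explicit because its increments satisfy a first-order
recurrence.
-/

section Paths

variable {S : Type*}

/-- Right-continuous step functions with left limits: the path regularity required of a Markov
chain, with the discrete topology on the state space expressed by eventual equality. -/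
structure IsCadlagStep (x : ℝ≥0 → S) : Prop where
  right_continuous : ∀ t, ∀ᶠ s in 𝓝[>] t, x s = x t
  left_limits : ∀ t, 0 < t → ∃ i, ∀ᶠ s in 𝓝[<] t, x s = i

theorem IsCadlagStep.exists_eventually_nhds_eq_ite {x : ℝ≥0 → S} (hx : IsCadlagStep x)
    (s : ℝ≥0) : ∃ i, ∀ᶠ r in 𝓝 s, x r = if r < s then i else x s := by
  have hright := eventually_nhdsWithin_iff.1 (hx.right_continuous s)
  have hleft : ∃ i, ∀ᶠ r in 𝓝 s, r < s → x r = i := by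
    rcases eq_or_ne s 0 with rfl | hs
    · exact ⟨x 0, Eventually.of_forall fun r hr => absurd hr not_lt_zero⟩
    · obtain ⟨i, hi⟩ := hx.left_limits s (pos_iff_ne_zero.2 hs)
      exact ⟨i, eventually_nhdsWithin_iff.1 hi⟩
  obtain ⟨i, hleft⟩ := hleft
  refine ⟨i, ?_⟩
  filter_upwards [hright, hleft] with r hr hl
  rcases lt_trichotomy r s with h | rfl | h
  · rw [if_pos h, hl h]
  · rw [if_neg (lt_irrefl r)]
  · rw [if_neg h.not_gt, hr h]

variable [LinearOrder S]

/-- The set of times at which a path jumps down. -/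
def downJumps (x : ℝ≥0 → S) : Set ℝ≥0 := {s | ∀ᶠ r in 𝓝[<] s, x s < x r}

/-- The number of downward jumps of a path in `(0, t]`. As for `Set.ncard`, it is `0` if there are
infinitely many of them. -/
noncomputable def downJumpCount (x : ℝ≥0 → S) (t : ℝ≥0) : ℕ := (downJumps x ∩ Set.Ioc 0 t).ncard

/-- The number of descents `u (k + 1) < u k`, `k < n`, of a sequence. -/
def descents (u : ℕ → S) (n : ℕ) : ℕ := Nat.count (fun k => u (k + 1) < u k) n

/-- The `k`-th point of the partition of `[0, t]` into `n` intervals of equal length. -/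
noncomputable def gridPoint (t : ℝ≥0) (n k : ℕ) : ℝ≥0 := t * (k / n)

/-- The number of descents of a path along the partition of `[0, t]` into `n` intervals of equal
length, a discrete approximation of `downJumpCount`. -/
noncomputable def gridDescents (x : ℝ≥0 → S) (t : ℝ≥0) (n : ℕ) : ℕ :=
  descents (fun k => x (gridPoint t n k)) n

theorem mem_downJumps_iff {x : ℝ≥0 → S} {s : ℝ≥0} {i : S} (hs : 0 < s)
    (hi : ∀ᶠ r in 𝓝[<] s, x r = i) : s ∈ downJumps x ↔ x s < i := by
  have : (𝓝[<] s).NeBot := nhdsLT_neBot_of_exists_lt ⟨0, hs⟩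
  exact (eventually_congr (hi.mono fun r hr => by rw [hr])).trans eventually_const

theorem mem_downJumps_iff_of_eq_ite {x : ℝ≥0 → S} {a b s r : ℝ≥0} {i : S}
    (h : ∀ q ∈ Set.Icc a b, x q = if q < s then i else x s) (hr : r ∈ Set.Ioc a b) :
    r ∈ downJumps x ↔ r = s ∧ x b < x a := by
  have hr0 : 0 < r := zero_le.trans_lt hr.1
  have hxr := h r (Set.Ioc_subset_Icc_self hr)
  rcases lt_or_ge s r with hsr | hrs
  · have hleft : ∀ᶠ q in 𝓝[<] r, x q = x s := by
      filter_upwards [Ioo_mem_nhdsLT (max_lt hr.1 hsr)] with q hq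
      obtain ⟨haq, hsq⟩ := max_lt_iff.1 hq.1
      rw [h q ⟨haq.le, hq.2.le.trans hr.2⟩, if_neg hsq.not_gt]
    rw [mem_downJumps_iff hr0 hleft, hxr, if_neg hsr.not_gt]
    simp [hsr.ne']
  · have hleft : ∀ᶠ q in 𝓝[<] r, x q = i := by
      filter_upwards [Ioo_mem_nhdsLT hr.1] with q hq
      rw [h q ⟨hq.1.le, hq.2.le.trans hr.2⟩, if_pos (hq.2.trans_le hrs)]
    rw [mem_downJumps_iff hr0 hleft, hxr]
    rcases hrs.lt_or_eq with hrs | rfl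
    · simp [hrs, hrs.ne]
    · have hab := hr.1.le.trans hr.2
      rw [h a ⟨le_rfl, hab⟩, h b ⟨hab, le_rfl⟩, if_pos hr.1, if_neg hr.2.not_gt]
      simp

theorem encard_downJumps_inter_Ioc {x : ℝ≥0 → S} {a b s : ℝ≥0} {i : S} (hab : a ≤ b)
    (h : ∀ r ∈ Set.Icc a b, x r = if r < s then i else x s) :
    (downJumps x ∩ Set.Ioc a b).encard = if x b < x a then 1 else 0 := by
  have hmem : ∀ r ∈ Set.Ioc a b, r ∈ downJumps x ↔ r = s ∧ x b < x a := fun r hr =>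
    mem_downJumps_iff_of_eq_ite h hr
  split_ifs with hlt
  · have hs : s ∈ Set.Ioc a b := by
      have hxa := h a ⟨le_rfl, hab⟩
      have hxb := h b ⟨hab, le_rfl⟩
      by_contra hs
      rw [Set.mem_Ioc, not_and_or, not_lt, not_le] at hs
      rcases hs with hs | hs
      · exact hlt.ne (by rw [hxa, hxb, if_neg hs.not_gt, if_neg (hs.trans hab).not_gt])
      · exact hlt.ne (by rw [hxa, hxb, if_pos hs, if_pos (hab.trans_lt hs)])
    rw [Set.encard_eq_one]
    refine ⟨s, Set.ext fun r => ⟨fun hr => ((hmem r hr.2).1 hr.1).1, ?_⟩⟩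
    rintro rfl
    exact ⟨(hmem r hs).2 ⟨rfl, hlt⟩, hs⟩
  · rw [Set.encard_eq_zero, Set.eq_empty_iff_forall_notMem]
    exact fun r hr => hlt ((hmem r hr.2).1 hr.1).2

theorem IsCadlagStep.exists_mesh {x : ℝ≥0 → S} (hx : IsCadlagStep x) (t : ℝ≥0) :
    ∃ δ : ℝ, 0 < δ ∧ ∀ a b : ℝ≥0, a ≤ b → b ≤ t → (b : ℝ) - a < δ →
      (downJumps x ∩ Set.Ioc a b).encard = if x b < x a then 1 else 0 := by
  choose i hi using hx.exists_eventually_nhds_eq_ite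
  obtain ⟨δ, hδ, hball⟩ := lebesgue_number_lemma_of_metric
    (isCompact_Icc (a := (0 : ℝ≥0)) (b := t))
    (c := fun s => interior {r | x r = if r < s then i s else x s})
    (fun s => isOpen_interior)
    (fun s _ => Set.mem_iUnion.2 ⟨s, mem_interior_iff_mem_nhds.2 (hi s)⟩)
  refine ⟨δ, hδ, fun a b hab hbt hlt => ?_⟩
  obtain ⟨s, hs⟩ := hball a ⟨zero_le, hab.trans hbt⟩
  refine encard_downJumps_inter_Ioc (s := s) (i := i s) hab fun r hr => ?_
  suffices hmem : r ∈ Metric.ball a δ from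
    interior_subset (s := {q | x q = if q < s then i s else x s}) (hs hmem)
  rw [Metric.mem_ball, NNReal.dist_eq, abs_of_nonneg (sub_nonneg.2 (by exact_mod_cast hr.1))]
  have : (r : ℝ) ≤ b := by exact_mod_cast hr.2
  linarith

theorem encard_downJumps_inter_Ioc_eq_descents {x : ℝ≥0 → S} {u : ℕ → ℝ≥0} (hu : Monotone u)
    (n : ℕ) (h : ∀ k < n, (downJumps x ∩ Set.Ioc (u k) (u (k + 1))).encard =
      if x (u (k + 1)) < x (u k) then 1 else 0) :
    (downJumps x ∩ Set.Ioc (u 0) (u n)).encard = descents (fun k => x (u k)) n := by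
  induction n with
  | zero => simp [descents]
  | succ n ih =>
    have hdisj : Disjoint (downJumps x ∩ Set.Ioc (u 0) (u n))
        (downJumps x ∩ Set.Ioc (u n) (u (n + 1))) :=
      (Set.Ioc_disjoint_Ioc_of_le le_rfl).mono Set.inter_subset_right Set.inter_subset_right
    rw [← Set.Ioc_union_Ioc_eq_Ioc (hu n.zero_le) (hu n.le_succ), Set.inter_union_distrib_left,
      Set.encard_union_eq hdisj, ih fun k hk => h k (hk.trans n.lt_succ_self),
      h n n.lt_succ_self, descents, descents, Nat.count_succ]
    push_cast
    rfl

theorem gridPoint_zero (t : ℝ≥0) (n : ℕ) : gridPoint t n 0 = 0 := by simp [gridPoint]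

theorem gridPoint_self (t : ℝ≥0) {n : ℕ} (hn : n ≠ 0) : gridPoint t n n = t := by
  simp [gridPoint, hn]

theorem monotone_gridPoint (t : ℝ≥0) (n : ℕ) : Monotone (gridPoint t n) := by
  intro j k hjk
  unfold gridPoint
  gcongr

theorem coe_gridPoint_sub (t : ℝ≥0) (n : ℕ) {j k : ℕ} (hjk : j ≤ k) :
    (gridPoint t n k : ℝ) - gridPoint t n j = (k - j : ℕ) * (t / n) := by
  rw [Nat.cast_sub hjk]
  simp only [gridPoint, NNReal.coe_mul, NNReal.coe_div, NNReal.coe_natCast]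
  ring

theorem gridPoint_mul_mul (t : ℝ≥0) (n k : ℕ) {m : ℕ} (hm : m ≠ 0) :
    gridPoint t (n * m) (k * m) = gridPoint t n k := by
  have hm' : (m : ℝ≥0) ≠ 0 := Nat.cast_ne_zero.2 hm
  simp only [gridPoint, Nat.cast_mul, mul_div_mul_right _ _ hm']

theorem IsCadlagStep.eventually_gridDescents_eq {x : ℝ≥0 → S} (hx : IsCadlagStep x) (t : ℝ≥0) :
    ∀ᶠ n in atTop, gridDescents x t n = downJumpCount x t := by
  obtain ⟨δ, hδ, hmesh⟩ := hx.exists_mesh t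
  have hlen : Tendsto (fun n : ℕ => (t : ℝ) / n) atTop (𝓝 0) :=
    tendsto_const_div_atTop_nhds_zero_nat _
  filter_upwards [hlen.eventually (gt_mem_nhds hδ), eventually_ne_atTop 0] with n hnδ hn
  have hcount := encard_downJumps_inter_Ioc_eq_descents (x := x) (monotone_gridPoint t n) n
    fun k hk => hmesh _ _ (monotone_gridPoint t n k.le_succ)
      ((monotone_gridPoint t n hk).trans_eq (gridPoint_self t hn))
      (by simpa [coe_gridPoint_sub t n k.le_succ] using hnδ)
  rw [gridPoint_zero, gridPoint_self t hn] at hcount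
  rw [downJumpCount, Set.ncard, hcount, ENat.toNat_natCast, gridDescents]

theorem descents_pos_of_lt {u : ℕ → S} {m : ℕ} (h : u m < u 0) : 0 < descents u m := by
  rw [Nat.pos_iff_ne_zero, descents, Nat.count_ne_iff_exists]
  by_contra! hmono
  have hle : ∀ k ≤ m, u 0 ≤ u k := by
    intro k hk
    induction k with
    | zero => exact le_rfl
    | succ k ih => exact (ih (Nat.le_of_succ_le hk)).trans (hmono k hk)
  exact h.not_ge (hle m le_rfl)

theorem descents_mul_right_le (u : ℕ → S) (n m : ℕ) :
    descents (fun k => u (k * m)) n ≤ descents u (n * m) := by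
  induction n with
  | zero => simp [descents]
  | succ n ih =>
    have hadd : descents u (n * m + m) =
        descents u (n * m) + descents (fun k => u (n * m + k)) m := Nat.count_add ..
    rw [Nat.succ_mul, hadd, descents, Nat.count_succ]
    refine add_le_add ih ?_
    split_ifs with h
    · exact descents_pos_of_lt (by simpa [Nat.succ_mul] using h)
    · exact Nat.zero_le _

theorem IsCadlagStep.gridDescents_le {x : ℝ≥0 → S} (hx : IsCadlagStep x) (t : ℝ≥0) (n : ℕ) :
    gridDescents x t n ≤ downJumpCount x t := by
  rcases eq_or_ne n 0 with rfl | hn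
  · simp [gridDescents, descents]
  have hrefine : Tendsto (fun m => n * m) atTop atTop :=
    tendsto_id.const_mul_atTop' (Nat.pos_of_ne_zero hn)
  obtain ⟨m, hm, hm0⟩ := ((hrefine.eventually (hx.eventually_gridDescents_eq t)).and
    (eventually_ne_atTop 0)).exists
  rw [← hm]
  simpa only [gridDescents, gridPoint_mul_mul t n _ hm0] using
    descents_mul_right_le (fun k => x (gridPoint t (n * m) k)) n m

end Paths

section MatrixSemigroup

open scoped Matrix

theorem tendsto_nat_smul_exp_smul_sub_one {A : Type*} [NormedRing A] [NormedAlgebra ℝ A]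
    [CompleteSpace A] (a : A) (t : ℝ) :
    Tendsto (fun n : ℕ => (n : ℝ) • (NormedSpace.exp ((t / n) • a) - 1)) atTop (𝓝 (t • a)) := by
  have hslope := hasDerivAt_iff_tendsto_slope_zero.1 (hasDerivAt_exp_smul_const' (t • a) (0 : ℝ))
  simp only [zero_smul, NormedSpace.exp_zero, mul_one, zero_add] at hslope
  have hinv : Tendsto (fun n : ℕ => (n : ℝ)⁻¹) atTop (𝓝[≠] 0) := by
    refine tendsto_nhdsWithin_iff.2 ⟨tendsto_inv_atTop_nhds_zero_nat, ?_⟩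
    filter_upwards [eventually_ne_atTop 0] with n hn
    exact inv_ne_zero (Nat.cast_ne_zero.2 hn)
  refine (hslope.comp hinv).congr fun n => ?_
  rw [Function.comp_apply, inv_inv, smul_smul, inv_mul_eq_div]

variable {S : Type*} [Fintype S] [DecidableEq S]

/-- The transition matrix `exp (t G)` over a time span `t` of the Markov chain with generator
`G`. -/
noncomputable def transitionMatrix (G : Matrix S S ℝ) (t : ℝ) : Matrix S S ℝ :=
  NormedSpace.exp (t • G)

variable {G : Matrix S S ℝ}

theorem transitionMatrix_zero : transitionMatrix G 0 = 1 := by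
  rw [transitionMatrix, zero_smul, NormedSpace.exp_zero]

theorem transitionMatrix_pow (t : ℝ) (k : ℕ) :
    transitionMatrix G t ^ k = transitionMatrix G (k * t) := by
  rw [transitionMatrix, transitionMatrix, ← Matrix.exp_nsmul, mul_smul, Nat.cast_smul_eq_nsmul]

open scoped Matrix.Norms.Operator in
theorem hasDerivAt_transitionMatrix (t : ℝ) :
    HasDerivAt (transitionMatrix G) (G * transitionMatrix G t) t :=
  hasDerivAt_exp_smul_const' G t

open scoped Matrix.Norms.Operator in
theorem hasDerivAt_dotProduct_transitionMatrix_mulVec (θ w : S → ℝ) (t : ℝ) :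
    HasDerivAt (fun s => θ ⬝ᵥ transitionMatrix G s *ᵥ w)
      (θ ⬝ᵥ G *ᵥ transitionMatrix G t *ᵥ w) t := by
  have hlin : IsLinearMap ℝ fun M : Matrix S S ℝ => θ ⬝ᵥ M *ᵥ w :=
    ⟨fun M N => by rw [Matrix.add_mulVec, dotProduct_add],
      fun c M => by rw [Matrix.smul_mulVec, dotProduct_smul]⟩
  rw [Matrix.mulVec_mulVec]
  exact (hlin.mk' _).toContinuousLinearMap.hasFDerivAt.comp_hasDerivAt t
    (hasDerivAt_transitionMatrix t)

theorem dotProduct_transitionMatrix_mulVec {θ : S → ℝ} (hθ : θ ᵥ* G = 0) (t : ℝ) (w : S → ℝ) :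
    θ ⬝ᵥ transitionMatrix G t *ᵥ w = θ ⬝ᵥ w := by
  have hderiv (s : ℝ) : HasDerivAt (fun s => θ ⬝ᵥ transitionMatrix G s *ᵥ w) 0 s :=
    (hasDerivAt_dotProduct_transitionMatrix_mulVec θ w s).congr_deriv <| by
      rw [Matrix.dotProduct_mulVec, hθ, zero_dotProduct]
  have hconst := is_const_of_deriv_eq_zero (fun s => (hderiv s).differentiableAt)
    (fun s => (hderiv s).deriv) t 0
  simpa only [transitionMatrix_zero, Matrix.one_mulVec] using hconst

/-- The difference quotient `n (P - 1)` of the semigroup generated by `G` at a time step `t / n`,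
where `P` is the transition matrix. It converges to `t G`. -/
noncomputable def approxGenerator (G : Matrix S S ℝ) (t : ℝ) (n : ℕ) : Matrix S S ℝ :=
  (n : ℝ) • (transitionMatrix G (t / n) - 1)

open scoped Matrix.Norms.Operator in
theorem tendsto_approxGenerator (t : ℝ) :
    Tendsto (approxGenerator G t) atTop (𝓝 (t • G)) :=
  tendsto_nat_smul_exp_smul_sub_one G t

theorem sum_transitionMatrix_mul_approxGenerator (t : ℝ) {n : ℕ} (hn : n ≠ 0) :
    (∑ k ∈ Finset.range n, transitionMatrix G (k * (t / n))) * approxGenerator G t n =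
      (n : ℝ) • (transitionMatrix G t - 1) := by
  have hn' : (n : ℝ) ≠ 0 := Nat.cast_ne_zero.2 hn
  simp only [approxGenerator, ← transitionMatrix_pow, mul_smul_comm, geom_sum_mul]
  rw [transitionMatrix_pow, mul_div_cancel₀ _ hn']

end MatrixSemigroup

section StrictLower

open scoped Matrix

variable {S : Type*} [LinearOrder S]

/-- The strictly lower triangular part of a matrix. For a generator, these are the rates of the
downward transitions. -/
def strictLower (M : Matrix S S ℝ) : Matrix S S ℝ :=
  Matrix.of fun i j => if j < i then M i j else 0

theorem strictLower_smul (c : ℝ) (M : Matrix S S ℝ) :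
    strictLower (c • M) = c • strictLower M := by
  ext i j
  simp [strictLower]

theorem strictLower_sub_one (M : Matrix S S ℝ) : strictLower (M - 1) = strictLower M := by
  ext i j
  simp only [strictLower, Matrix.of_apply, Matrix.sub_apply]
  split_ifs with h
  · rw [Matrix.one_apply_ne h.ne', sub_zero]
  · rfl

theorem continuous_strictLower : Continuous (strictLower : Matrix S S ℝ → Matrix S S ℝ) := by
  refine continuous_matrix fun i j => ?_
  simp only [strictLower, Matrix.of_apply]
  split_ifs
  · exact continuous_id.matrix_elem i j
  · exact continuous_const

variable [Fintype S]

theorem smul_strictLower_transitionMatrix (G : Matrix S S ℝ) (t : ℝ) (n : ℕ) :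
    (n : ℝ) • strictLower (transitionMatrix G (t / n)) = strictLower (approxGenerator G t n) := by
  rw [approxGenerator, strictLower_smul, strictLower_sub_one]

end StrictLower

section MarkovChain

open scoped Matrix

variable {Ω : Type*} [MeasurableSpace Ω] {P : Measure Ω} {S : Type*}

/-- The probability mass function of a random variable. -/
noncomputable def law (P : Measure Ω) (Y : Ω → S) : S → ℝ := fun i => P.real {ω | Y ω = i}

theorem integral_comp_eq_law_dotProduct [Fintype S] [MeasurableSpace S]
    [MeasurableSingletonClass S] [IsFiniteMeasure P] {Y : Ω → S} (hY : Measurable Y) (f : S → ℝ) :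
    ∫ ω, f (Y ω) ∂P = law P Y ⬝ᵥ f := by
  rw [← integral_map hY.aemeasurable (measurable_of_finite f).aestronglyMeasurable,
    integral_fintype .of_finite]
  refine Finset.sum_congr rfl fun i _ => ?_
  rw [map_measureReal_apply hY (measurableSet_singleton i)]
  rfl

theorem law_dotProduct_le [Fintype S] [IsFiniteMeasure P] (Y : Ω → S) (v : S → ℝ) :
    law P Y ⬝ᵥ v ≤ P.real Set.univ * ∑ i, |v i| := by
  rw [dotProduct, Finset.mul_sum]
  refine Finset.sum_le_sum fun i _ => ?_
  calc law P Y i * v i ≤ law P Y i * |v i| :=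
        mul_le_mul_of_nonneg_left (le_abs_self _) measureReal_nonneg
    _ ≤ P.real Set.univ * |v i| :=
        mul_le_mul_of_nonneg_right (measureReal_mono (Set.subset_univ _)) (abs_nonneg _)

variable [Fintype S] [LinearOrder S] {G : Matrix S S ℝ} {X : ℝ≥0 → Ω → S}

namespace IsMarkovChainWithGenerator

theorem law_pair (hX : IsMarkovChainWithGenerator G P X) {s t : ℝ≥0} (hst : s ≤ t) (i j : S) :
    law P (fun ω => (X s ω, X t ω)) (i, j) = law P (X s) i * transitionMatrix G (t - s) i j := by
  have hmono : Monotone ![s, t] := by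
    rw [Fin.monotone_iff_le_succ]
    intro k
    fin_cases k
    exact hst
  simpa [Fin.forall_fin_two, law, transitionMatrix] using hX.markov 1 ![s, t] ![i, j] hmono

theorem law_triple (hX : IsMarkovChainWithGenerator G P X) {r s t : ℝ≥0} (hrs : r ≤ s)
    (hst : s ≤ t) (i j l : S) :
    law P (fun ω => (X r ω, X s ω, X t ω)) (i, j, l) =
      law P (X r) i * (transitionMatrix G (s - r) i j * transitionMatrix G (t - s) j l) := by
  have hmono : Monotone ![r, s, t] := by
    rw [Fin.monotone_iff_le_succ]
    intro k
    fin_cases k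
    · exact hrs
    · exact hst
  simpa [Fin.forall_fin_succ, Fin.prod_univ_two, law, transitionMatrix] using
    hX.markov 2 ![r, s, t] ![i, j, l] hmono

variable [MeasurableSpace S]

theorem measurable (hX : IsMarkovChainWithGenerator G P X) (t : ℝ≥0) : Measurable (X t) :=
  measurable_to_countable' fun i => hX.measurableSet_eq t i

variable [MeasurableSingletonClass S] [IsFiniteMeasure P]

theorem integral_comp (hX : IsMarkovChainWithGenerator G P X) {s t : ℝ≥0} (hst : s ≤ t)
    (g : S → ℝ) :
    ∫ ω, g (X t ω) ∂P = law P (X s) ⬝ᵥ transitionMatrix G (t - s) *ᵥ g := by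
  rw [integral_comp_eq_law_dotProduct ((hX.measurable s).prodMk (hX.measurable t)) fun y => g y.2]
  simp only [dotProduct, Matrix.mulVec, Fintype.sum_prod_type, hX.law_pair hst, Finset.mul_sum,
    mul_assoc]

theorem law_eq_law_zero (hX : IsMarkovChainWithGenerator G P X)
    (hstat : law P (X 0) ᵥ* G = 0) (t : ℝ≥0) : law P (X t) = law P (X 0) := by
  refine dotProduct_eq _ _ fun g => ?_
  rw [← integral_comp_eq_law_dotProduct (hX.measurable t), hX.integral_comp zero_le,
    dotProduct_transitionMatrix_mulVec hstat]

theorem integral_descent_mul (hX : IsMarkovChainWithGenerator G P X) {r s t : ℝ≥0} (hrs : r ≤ s)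
    (hst : s ≤ t) (g : S → ℝ) :
    ∫ ω, (if X s ω < X r ω then 1 else 0) * g (X t ω) ∂P =
      law P (X r) ⬝ᵥ
        strictLower (transitionMatrix G (s - r)) *ᵥ transitionMatrix G (t - s) *ᵥ g := by
  rw [integral_comp_eq_law_dotProduct
    ((hX.measurable r).prodMk ((hX.measurable s).prodMk (hX.measurable t)))
    fun y => (if y.2.1 < y.1 then 1 else 0) * g y.2.2]
  simp only [dotProduct, Matrix.mulVec, Fintype.sum_prod_type, hX.law_triple hrs hst,
    Finset.mul_sum, strictLower, Matrix.of_apply]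
  refine Finset.sum_congr rfl fun i _ => Finset.sum_congr rfl fun j _ =>
    Finset.sum_congr rfl fun l _ => ?_
  split_ifs <;> ring

end IsMarkovChainWithGenerator

end MarkovChain

section JumpCount

open scoped Matrix

theorem integrable_of_tendsto_of_integral_norm_le {α E : Type*} [MeasurableSpace α]
    [NormedAddCommGroup E] {μ : Measure α} {F : ℕ → α → E} {f : α → E} {C : ℝ}
    (hF : ∀ n, Integrable (F n) μ) (hC : ∀ n, ∫ a, ‖F n a‖ ∂μ ≤ C)
    (hlim : ∀ᵐ a ∂μ, Tendsto (fun n => F n a) atTop (𝓝 (f a))) : Integrable f μ := by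
  refine ⟨aestronglyMeasurable_of_tendsto_ae atTop (fun n => (hF n).1) hlim, ?_⟩
  calc ∫⁻ a, ‖f a‖ₑ ∂μ = ∫⁻ a, liminf (fun n => ‖F n a‖ₑ) atTop ∂μ :=
        lintegral_congr_ae (hlim.mono fun a ha => ha.enorm.liminf_eq.symm)
    _ ≤ liminf (fun n => ∫⁻ a, ‖F n a‖ₑ ∂μ) atTop :=
        lintegral_liminf_le' fun n => (hF n).1.enorm
    _ ≤ liminf (fun _ => ENNReal.ofReal C) atTop := by
        refine liminf_le_liminf (Eventually.of_forall fun n => ?_)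
        rw [← ofReal_integral_norm_eq_lintegral_enorm (hF n)]
        exact ENNReal.ofReal_le_ofReal (hC n)
    _ < ⊤ := by simp

theorem natCast_gridDescents {S : Type*} [LinearOrder S] (x : ℝ≥0 → S) (t : ℝ≥0) (n : ℕ) :
    (gridDescents x t n : ℝ) = ∑ k ∈ Finset.range n,
      if x (gridPoint t n (k + 1)) < x (gridPoint t n k) then 1 else 0 := by
  rw [gridDescents, descents, Nat.count_eq_card_filter_range, Finset.natCast_card_filter]

variable {Ω : Type*} [MeasurableSpace Ω] {P : Measure Ω} {S : Type*} [Fintype S] [LinearOrder S]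
  {G : Matrix S S ℝ} {X : ℝ≥0 → Ω → S}

namespace IsMarkovChainWithGenerator

theorem ae_isCadlagStep (hX : IsMarkovChainWithGenerator G P X) :
    ∀ᵐ ω ∂P, IsCadlagStep fun s => X s ω := by
  filter_upwards [hX.right_continuous, hX.left_limits] with ω hright hleft using ⟨hright, hleft⟩

theorem ae_tendsto_gridDescents (hX : IsMarkovChainWithGenerator G P X) (t : ℝ≥0) :
    ∀ᵐ ω ∂P, Tendsto (fun n => (gridDescents (fun s => X s ω) t n : ℝ)) atTop
      (𝓝 (downJumpCount (fun s => X s ω) t)) := by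
  filter_upwards [hX.ae_isCadlagStep] with ω hω
  exact tendsto_const_nhds.congr' <|
    (hω.eventually_gridDescents_eq t).mono fun n hn => by simp only [hn]

variable [MeasurableSpace S] [MeasurableSingletonClass S] [IsFiniteMeasure P]

theorem integrable_descent_mul (hX : IsMarkovChainWithGenerator G P X) (r s t : ℝ≥0) (g : S → ℝ) :
    Integrable (fun ω => (if X s ω < X r ω then 1 else 0) * g (X t ω)) P :=
  Integrable.comp_measurable (g := fun y : S × S × S => (if y.2.1 < y.1 then 1 else 0) * g y.2.2)
    .of_finite ((hX.measurable r).prodMk ((hX.measurable s).prodMk (hX.measurable t)))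

theorem integrable_gridDescents_mul (hX : IsMarkovChainWithGenerator G P X) (t : ℝ≥0) (n : ℕ)
    (g : S → ℝ) :
    Integrable (fun ω => (gridDescents (fun s => X s ω) t n : ℝ) * g (X t ω)) P := by
  simp only [natCast_gridDescents, Finset.sum_mul]
  exact integrable_finsetSum _ fun k _ => hX.integrable_descent_mul _ _ t g

theorem integral_gridDescents_le (hX : IsMarkovChainWithGenerator G P X) (t : ℝ≥0) (n : ℕ) :
    ∫ ω, (gridDescents (fun s => X s ω) t n : ℝ) ∂P ≤
      P.real Set.univ * ∑ i, |(strictLower (approxGenerator G t n) *ᵥ 1) i| := by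
  have hstep (k : ℕ) : ∫ ω, (if X (gridPoint t n (k + 1)) ω < X (gridPoint t n k) ω then
      (1 : ℝ) else 0) ∂P ≤
      P.real Set.univ * ∑ i, |(strictLower (transitionMatrix G (t / n)) *ᵥ 1) i| := by
    have h := hX.integral_descent_mul (monotone_gridPoint t n k.le_succ) le_rfl 1
    rw [coe_gridPoint_sub t n k.le_succ, sub_self, transitionMatrix_zero, Matrix.one_mulVec] at h
    simp only [Pi.one_apply, mul_one, Nat.succ_eq_add_one, Nat.add_sub_cancel_left, Nat.cast_one,
      one_mul] at h
    exact h.trans_le (law_dotProduct_le _ _)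
  simp only [natCast_gridDescents]
  rw [integral_finsetSum _ fun k _ => by
    simpa using hX.integrable_descent_mul (gridPoint t n k) (gridPoint t n (k + 1)) t 1]
  refine (Finset.sum_le_card_nsmul _ _ _ fun k _ => hstep k).trans_eq ?_
  rw [Finset.card_range, nsmul_eq_mul, mul_left_comm, Finset.mul_sum,
    ← smul_strictLower_transitionMatrix, Matrix.smul_mulVec]
  simp only [Pi.smul_apply, smul_eq_mul, abs_mul, Nat.abs_cast]

theorem integrable_downJumpCount (hX : IsMarkovChainWithGenerator G P X) (t : ℝ≥0) :
    Integrable (fun ω => (downJumpCount (fun s => X s ω) t : ℝ)) P := by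
  have hcont : Continuous fun M : Matrix S S ℝ =>
      P.real Set.univ * ∑ i, |(strictLower M *ᵥ 1) i| := by
    have := continuous_strictLower (S := S)
    fun_prop
  obtain ⟨C, hC⟩ := ((hcont.tendsto _).comp (tendsto_approxGenerator t)).bddAbove_range
  refine integrable_of_tendsto_of_integral_norm_le (C := C)
    (fun n => by simpa using hX.integrable_gridDescents_mul t n 1) (fun n => ?_)
    (hX.ae_tendsto_gridDescents t)
  simp only [Real.norm_natCast]
  exact (hX.integral_gridDescents_le t n).trans (hC ⟨n, rfl⟩)

theorem integrable_downJumpCount_mul (hX : IsMarkovChainWithGenerator G P X) (t : ℝ≥0)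
    (g : S → ℝ) :
    Integrable (fun ω => (downJumpCount (fun s => X s ω) t : ℝ) * g (X t ω)) P :=
  (hX.integrable_downJumpCount t).mul_bdd (c := ‖g‖)
    ((measurable_of_finite g).comp (hX.measurable t)).aestronglyMeasurable
    (Eventually.of_forall fun ω => norm_le_pi_norm g (X t ω))

theorem integral_gridDescents_mul_approxGenerator (hX : IsMarkovChainWithGenerator G P X)
    (hstat : law P (X 0) ᵥ* G = 0) (t : ℝ≥0) (n : ℕ) (w : S → ℝ) :
    ∫ ω, (gridDescents (fun s => X s ω) t n : ℝ) * (approxGenerator G t n *ᵥ w) (X t ω) ∂P =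
      law P (X 0) ⬝ᵥ strictLower (approxGenerator G t n) *ᵥ (transitionMatrix G t *ᵥ w - w) := by
  rcases eq_or_ne n 0 with rfl | hn
  · rw [approxGenerator, strictLower_smul]
    simp [gridDescents, descents]
  have hstep : ∀ k ∈ Finset.range n, ∫ ω, (if X (gridPoint t n (k + 1)) ω < X (gridPoint t n k) ω
      then (1 : ℝ) else 0) * (approxGenerator G t n *ᵥ w) (X t ω) ∂P =
      law P (X 0) ⬝ᵥ strictLower (transitionMatrix G (t / n)) *ᵥ
        transitionMatrix G ((n - 1 - k : ℕ) * (t / n)) *ᵥ approxGenerator G t n *ᵥ w := by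
    intro k hk
    have hkn : k + 1 ≤ n := Finset.mem_range.1 hk
    have h := hX.integral_descent_mul (monotone_gridPoint t n k.le_succ)
      (monotone_gridPoint t n hkn) (approxGenerator G t n *ᵥ w)
    rw [coe_gridPoint_sub t n k.le_succ, coe_gridPoint_sub t n hkn, gridPoint_self t hn,
      hX.law_eq_law_zero hstat, Nat.add_comm k 1, ← Nat.sub_sub] at h
    simpa [Nat.add_comm 1 k] using h
  simp only [natCast_gridDescents, Finset.sum_mul]
  rw [integral_finsetSum _ fun k _ => hX.integrable_descent_mul _ _ t _,
    Finset.sum_congr rfl hstep, Finset.sum_range_reflect fun k => law P (X 0) ⬝ᵥ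
      strictLower (transitionMatrix G (t / n)) *ᵥ transitionMatrix G (k * (t / n)) *ᵥ
        approxGenerator G t n *ᵥ w]
  rw [← dotProduct_sum, ← Matrix.mulVec_sum, ← Matrix.sum_mulVec, Matrix.mulVec_mulVec w,
    sum_transitionMatrix_mul_approxGenerator _ hn, ← smul_strictLower_transitionMatrix,
    Matrix.smul_mulVec, Matrix.smul_mulVec, Matrix.mulVec_smul, Matrix.sub_mulVec,
    Matrix.one_mulVec]

theorem integral_downJumpCount_mul_mulVec (hX : IsMarkovChainWithGenerator G P X)
    (hstat : law P (X 0) ᵥ* G = 0) (t : ℝ≥0) (w : S → ℝ) :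
    ∫ ω, (downJumpCount (fun s => X s ω) t : ℝ) * (G *ᵥ w) (X t ω) ∂P =
      law P (X 0) ⬝ᵥ strictLower G *ᵥ (transitionMatrix G t *ᵥ w - w) := by
  rcases eq_or_ne t 0 with rfl | ht
  · simp [downJumpCount, transitionMatrix_zero]
  have hG : Tendsto (fun n => approxGenerator G t n *ᵥ w) atTop (𝓝 (((t : ℝ) • G) *ᵥ w)) :=
    ((continuous_id.matrix_mulVec continuous_const).tendsto _).comp (tendsto_approxGenerator t)
  obtain ⟨C, hC⟩ := hG.norm.bddAbove_range
  have hleft : Tendsto (fun n => ∫ ω, (gridDescents (fun s => X s ω) t n : ℝ) *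
        (approxGenerator G t n *ᵥ w) (X t ω) ∂P) atTop
      (𝓝 (∫ ω, (downJumpCount (fun s => X s ω) t : ℝ) * (((t : ℝ) • G) *ᵥ w) (X t ω) ∂P)) := by
    refine tendsto_integral_of_dominated_convergence
      (fun ω => (downJumpCount (fun s => X s ω) t : ℝ) * C)
      (fun n => (hX.integrable_gridDescents_mul t n _).1)
      ((hX.integrable_downJumpCount t).mul_const C) (fun n => ?_) ?_
    · filter_upwards [hX.ae_isCadlagStep] with ω hω
      rw [norm_mul, Real.norm_natCast]
      gcongr
      · exact hω.gridDescents_le t n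
      · exact (norm_le_pi_norm _ _).trans (hC ⟨n, rfl⟩)
    · filter_upwards [hX.ae_tendsto_gridDescents t] with ω hω
      exact hω.mul (tendsto_pi_nhds.1 hG (X t ω))
  have hright : Tendsto (fun n => law P (X 0) ⬝ᵥ
        strictLower (approxGenerator G t n) *ᵥ (transitionMatrix G t *ᵥ w - w)) atTop
      (𝓝 (law P (X 0) ⬝ᵥ strictLower ((t : ℝ) • G) *ᵥ (transitionMatrix G t *ᵥ w - w))) :=
    ((continuous_const.dotProduct
      (continuous_strictLower.matrix_mulVec continuous_const)).tendsto _).comp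
      (tendsto_approxGenerator t)
  have hlim := tendsto_nhds_unique hleft <| hright.congr fun n =>
    (hX.integral_gridDescents_mul_approxGenerator hstat t n w).symm
  simp only [Matrix.smul_mulVec, strictLower_smul, Pi.smul_apply, smul_eq_mul, dotProduct_smul,
    mul_left_comm _ (t : ℝ), integral_const_mul] at hlim
  exact mul_left_cancel₀ (NNReal.coe_ne_zero.2 ht) hlim

end IsMarkovChainWithGenerator

end JumpCount

section ConvergenceToEquilibrium

open scoped Matrix

theorem tendsto_zero_of_hasDerivAt_of_le_neg_mul {f f' : ℝ → ℝ} {a : ℝ} (ha : 0 < a)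
    (hf : ∀ t, HasDerivAt f (f' t) t) (hf' : ∀ t, f' t ≤ -a * f t) (h0 : ∀ t, 0 ≤ f t) :
    Tendsto f atTop (𝓝 0) := by
  have hexp : Tendsto (fun t => f 0 * Real.exp (-a * t)) atTop (𝓝 0) := by
    simpa using (Real.tendsto_exp_atBot.comp
      (tendsto_id.const_mul_atTop_of_neg (neg_lt_zero.2 ha))).const_mul (f 0)
  refine squeeze_zero' (Eventually.of_forall h0) ?_ hexp
  filter_upwards [eventually_ge_atTop 0] with t ht
  have hgronwall := le_gronwallBound_of_liminf_deriv_right_le (f := f) (f' := f') (δ := f 0)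
    (K := -a) (ε := 0) (a := 0) (b := t) (fun x _ => (hf x).continuousAt.continuousWithinAt)
    (fun x _ _ hr => (hf x).hasDerivWithinAt.liminf_right_slope_le hr) le_rfl
    (fun x _ => by simpa using hf' x) t ⟨ht, le_rfl⟩
  rwa [gronwallBound_ε0, sub_zero] at hgronwall

variable {S : Type*} [Fintype S] [DecidableEq S] {G : Matrix S S ℝ} {θ : S → ℝ}

theorem hasDerivAt_transitionMatrix_mulVec_apply (w : S → ℝ) (t : ℝ) (i : S) :
    HasDerivAt (fun s => (transitionMatrix G s *ᵥ w) i) ((G *ᵥ transitionMatrix G t *ᵥ w) i) t := by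
  simpa only [single_one_dotProduct] using
    hasDerivAt_dotProduct_transitionMatrix_mulVec (G := G) (Pi.single i 1) w t

/-- The squared distance in `L²(θ)` of `transitionMatrix G t *ᵥ w` from the constant function with
value `θ ⬝ᵥ w`, its presumed limit. -/
noncomputable def equilibriumDistSq (G : Matrix S S ℝ) (θ w : S → ℝ) (t : ℝ) : ℝ :=
  ∑ i, θ i * ((transitionMatrix G t *ᵥ w) i - θ ⬝ᵥ w) ^ 2

theorem hasDerivAt_equilibriumDistSq (hG : G *ᵥ 1 = 0) (w : S → ℝ) (t : ℝ) :
    let u := transitionMatrix G t *ᵥ w - (θ ⬝ᵥ w) • 1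
    HasDerivAt (equilibriumDistSq G θ w) (2 * ∑ i, θ i * u i * (G *ᵥ u) i) t := by
  intro u
  have hGu : G *ᵥ u = G *ᵥ transitionMatrix G t *ᵥ w := by
    rw [Matrix.mulVec_sub, Matrix.mulVec_smul, hG, smul_zero, sub_zero]
  have hterm (i : S) : HasDerivAt (fun s => θ i * ((transitionMatrix G s *ᵥ w) i - θ ⬝ᵥ w) ^ 2)
      (2 * (θ i * u i * (G *ᵥ u) i)) t := by
    refine ((((hasDerivAt_transitionMatrix_mulVec_apply w t i).sub_const (θ ⬝ᵥ w)).fun_pow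
      2).const_mul (θ i)).congr_deriv ?_
    simp only [hGu, u, Pi.sub_apply, Pi.smul_apply, Pi.one_apply, smul_eq_mul]
    ring
  rw [Finset.mul_sum]
  exact HasDerivAt.fun_sum fun i _ => hterm i

theorem tendsto_equilibriumDistSq (hθ : ∀ i, 0 ≤ θ i) (hsum : ∑ i, θ i = 1) (hstat : θ ᵥ* G = 0)
    (hG : G *ᵥ 1 = 0) {a : ℝ} (ha : 0 < a)
    (hgap : ∀ u : S → ℝ, θ ⬝ᵥ u = 0 →
      a * ∑ i, θ i * u i ^ 2 ≤ -∑ i, θ i * u i * (G *ᵥ u) i) (w : S → ℝ) :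
    Tendsto (equilibriumDistSq G θ w) atTop (𝓝 0) := by
  refine tendsto_zero_of_hasDerivAt_of_le_neg_mul (a := 2 * a) (by positivity)
    (fun t => hasDerivAt_equilibriumDistSq hG w t) (fun t => ?_)
    fun t => Finset.sum_nonneg fun i _ => mul_nonneg (hθ i) (sq_nonneg _)
  have hmean : θ ⬝ᵥ (transitionMatrix G t *ᵥ w - (θ ⬝ᵥ w) • 1) = 0 := by
    rw [dotProduct_sub, dotProduct_transitionMatrix_mulVec hstat, dotProduct_smul, dotProduct_one,
      hsum, smul_eq_mul, mul_one, sub_self]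
  have hdecay := hgap _ hmean
  simp only [equilibriumDistSq, Pi.sub_apply, Pi.smul_apply, Pi.one_apply, smul_eq_mul,
    mul_one] at hdecay ⊢
  linarith

theorem tendsto_transitionMatrix_mulVec_apply (hθ : ∀ i, 0 < θ i) (hsum : ∑ i, θ i = 1)
    (hstat : θ ᵥ* G = 0) (hG : G *ᵥ 1 = 0) {a : ℝ} (ha : 0 < a)
    (hgap : ∀ u : S → ℝ, θ ⬝ᵥ u = 0 →
      a * ∑ i, θ i * u i ^ 2 ≤ -∑ i, θ i * u i * (G *ᵥ u) i) (w : S → ℝ) (i : S) :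
    Tendsto (fun t => (transitionMatrix G t *ᵥ w) i) atTop (𝓝 (θ ⬝ᵥ w)) := by
  have hlim : Tendsto (fun t => (θ i)⁻¹ * equilibriumDistSq G θ w t) atTop (𝓝 0) := by
    simpa using (tendsto_equilibriumDistSq (fun j => (hθ j).le) hsum hstat hG ha hgap w).const_mul
      (θ i)⁻¹
  have hsq : Tendsto (fun t => ((transitionMatrix G t *ᵥ w) i - θ ⬝ᵥ w) ^ 2) atTop (𝓝 0) := by
    refine squeeze_zero (fun t => sq_nonneg _) (fun t => ?_) hlim
    rw [inv_mul_eq_div, le_div_iff₀' (hθ i)]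
    exact Finset.single_le_sum
      (f := fun j => θ j * ((transitionMatrix G t *ᵥ w) j - θ ⬝ᵥ w) ^ 2)
      (fun j _ => mul_nonneg (hθ j).le (sq_nonneg _)) (Finset.mem_univ i)
  rw [← tendsto_sub_nhds_zero_iff, tendsto_zero_iff_abs_tendsto_zero]
  simpa [Real.sqrt_sq_eq_abs, Function.comp_def] using hsq.sqrt

end ConvergenceToEquilibrium

section CovarianceJumpCount

open scoped Matrix

theorem covariance_eq_integral_mul_of_integral_eq_zero {Ω : Type*} [MeasurableSpace Ω]
    {μ : Measure Ω} {X Y : Ω → ℝ} (hXY : Integrable (fun ω => X ω * Y ω) μ) (hY : Integrable Y μ)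
    (h0 : ∫ ω, Y ω ∂μ = 0) : cov[X, Y; μ] = ∫ ω, X ω * Y ω ∂μ := by
  simp only [covariance, h0, sub_zero, sub_mul]
  rw [integral_sub hXY (hY.const_mul _), integral_const_mul, h0, mul_zero, sub_zero]

variable {Ω : Type*} [MeasurableSpace Ω] {P : Measure Ω} [IsProbabilityMeasure P] {S : Type*}
  [Fintype S] [LinearOrder S] [MeasurableSpace S] [MeasurableSingletonClass S] {G : Matrix S S ℝ}
  {X : ℝ≥0 → Ω → S}

theorem IsMarkovChainWithGenerator.covariance_downJumpCount
    (hX : IsMarkovChainWithGenerator G P X) (hstat : law P (X 0) ᵥ* G = 0) {f w : S → ℝ} {m : ℝ}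
    (hw : ∀ i, (G *ᵥ w) i = m - f i) (t : ℝ≥0) :
    cov[fun ω => (downJumpCount (fun s => X s ω) t : ℝ), fun ω => f (X t ω); P] =
      law P (X 0) ⬝ᵥ strictLower G *ᵥ (w - transitionMatrix G t *ᵥ w) := by
  have hGw : Integrable (fun ω => (G *ᵥ w) (X t ω)) P :=
    (Integrable.of_finite (f := G *ᵥ w)).comp_measurable (hX.measurable t)
  have hmean : ∫ ω, (G *ᵥ w) (X t ω) ∂P = 0 := by
    rw [integral_comp_eq_law_dotProduct (hX.measurable t), hX.law_eq_law_zero hstat,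
      Matrix.dotProduct_mulVec, hstat, zero_dotProduct]
  have hf : (fun ω => f (X t ω)) = fun ω => m - (G *ᵥ w) (X t ω) := by
    funext ω
    rw [hw, sub_sub_cancel]
  rw [hf, covariance_const_sub_right hGw, covariance_eq_integral_mul_of_integral_eq_zero
    (hX.integrable_downJumpCount_mul t _) hGw hmean, hX.integral_downJumpCount_mul_mulVec hstat,
    ← dotProduct_neg, ← Matrix.mulVec_neg, neg_sub]

end CovarianceJumpCount

section Generator

open scoped Matrix

variable {K : ℕ} {lam mu : ℝ}

theorem mm1kGenerator_apply (K : ℕ) (lam mu : ℝ) (i j : Fin (K + 1)) :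
    mm1kGenerator K lam mu i j =
      (if (j : ℕ) = i + 1 then lam else 0) + (if (i : ℕ) = j + 1 then mu else 0) +
        if (j : ℕ) = i then
          -((if (i : ℕ) < K then lam else 0) + (if 0 < (i : ℕ) then mu else 0)) else 0 := by
  simp only [mm1kGenerator, Matrix.of_apply, Fin.ext_iff, eq_comm (a := (i : ℕ)) (b := j)]
  by_cases hup : (j : ℕ) = i + 1
  · simp [hup]
    omega
  · simp only [hup, if_false, zero_add]
    split_ifs <;> first | omega | simp

theorem sum_range_ite_eq_add_one (f : ℕ → ℝ) (N i : ℕ) :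
    ∑ j ∈ Finset.range N, (if i = j + 1 then f j else 0) =
      if 0 < i ∧ i ≤ N then f (i - 1) else 0 := by
  rcases i with _ | i <;> simp

theorem mm1kGenerator_mulVec (W : ℕ → ℝ) (i : Fin (K + 1)) :
    (mm1kGenerator K lam mu *ᵥ fun j => W j) i =
      (if (i : ℕ) < K then lam * (W (i + 1) - W i) else 0) +
        if 0 < (i : ℕ) then mu * (W (i - 1) - W i) else 0 := by
  have hsum : (mm1kGenerator K lam mu *ᵥ fun j => W j) i =
      ∑ j ∈ Finset.range (K + 1), ((if j = (i : ℕ) + 1 then lam * W j else 0) +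
        (if (i : ℕ) = j + 1 then mu * W j else 0) + if j = (i : ℕ) then
          -((if (i : ℕ) < K then lam else 0) + (if 0 < (i : ℕ) then mu else 0)) * W j else 0) := by
    rw [← Fin.sum_univ_eq_sum_range (α := ℝ), Matrix.mulVec, dotProduct]
    simp only [mm1kGenerator_apply, add_mul, ite_mul, zero_mul]
  rw [hsum, Finset.sum_add_distrib, Finset.sum_add_distrib, sum_range_ite_eq_add_one]
  simp only [Finset.sum_ite_eq', Finset.mem_range, i.is_lt, i.is_lt.le, if_true, and_true,
    Nat.add_lt_add_iff_right]
  split_ifs <;> ring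

theorem mm1kGenerator_mulVec_one : mm1kGenerator K lam mu *ᵥ 1 = 0 := by
  funext i
  exact (mm1kGenerator_mulVec (fun _ => 1) i).trans (by simp)

theorem strictLower_mm1kGenerator_mulVec (W : ℕ → ℝ) (i : Fin (K + 1)) :
    (strictLower (mm1kGenerator K lam mu) *ᵥ fun j => W j) i =
      if 0 < (i : ℕ) then mu * W (i - 1) else 0 := by
  have hentry (j : Fin (K + 1)) : strictLower (mm1kGenerator K lam mu) i j =
      if (i : ℕ) = j + 1 then mu else 0 := by
    simp only [strictLower, Matrix.of_apply, mm1kGenerator_apply, Fin.lt_def]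
    split_ifs <;> first | omega | simp
  simp only [Matrix.mulVec, dotProduct, hentry, ite_mul, zero_mul]
  rw [Fin.sum_univ_eq_sum_range (fun j => if (i : ℕ) = j + 1 then mu * W j else 0),
    sum_range_ite_eq_add_one]
  simp only [i.is_lt.le, and_true]

theorem sum_mul_mm1kGenerator_mulVec (T W : ℕ → ℝ) :
    ∑ i : Fin (K + 1), T i * (mm1kGenerator K lam mu *ᵥ fun j => W j) i =
      ∑ k ∈ Finset.range K, (lam * T k - mu * T (k + 1)) * (W (k + 1) - W k) := by
  simp only [mm1kGenerator_mulVec, mul_add]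
  rw [Finset.sum_add_distrib, Fin.sum_univ_eq_sum_range fun i =>
      T i * if i < K then lam * (W (i + 1) - W i) else 0,
    Fin.sum_univ_eq_sum_range fun i => T i * if 0 < i then mu * (W (i - 1) - W i) else 0,
    Finset.sum_range_succ, Finset.sum_range_succ' _ K]
  simp only [lt_irrefl, if_false, mul_zero, add_zero, Nat.succ_pos, if_true, Nat.add_sub_cancel]
  rw [← Finset.sum_add_distrib]
  refine Finset.sum_congr rfl fun k hk => ?_
  rw [if_pos (Finset.mem_range.1 hk)]
  ring

/-- Testing stationarity against the indicator function of `{n + 1, …, K}` isolates the flux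
across the edge between `n` and `n + 1`. -/
theorem detailedBalance_of_vecMul_mm1kGenerator {T : ℕ → ℝ}
    (hT : (fun i : Fin (K + 1) => T i) ᵥ* mm1kGenerator K lam mu = 0) {n : ℕ} (hn : n < K) :
    lam * T n = mu * T (n + 1) := by
  have hflux := sum_mul_mm1kGenerator_mulVec (K := K) (lam := lam) (mu := mu) T
    fun k => if n < k then 1 else 0
  change (fun i : Fin (K + 1) => T i) ⬝ᵥ _ = _ at hflux
  rw [Matrix.dotProduct_mulVec, hT, zero_dotProduct, Finset.sum_eq_single_of_mem n
    (Finset.mem_range.2 hn) fun k _ hk => ?_] at hflux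
  · simpa [sub_eq_zero] using hflux.symm
  · have : n < k + 1 ↔ n < k := by omega
    simp [this]

/-- The truncated geometric distribution with ratio `ρ` on `{0, …, K}`, as a function on `ℕ`
(whose values beyond `K` are irrelevant). -/
noncomputable def truncatedGeometric (K : ℕ) (ρ : ℝ) (n : ℕ) : ℝ :=
  ρ ^ n / ∑ k ∈ Finset.range (K + 1), ρ ^ k

variable {ρ : ℝ}

theorem truncatedGeometric_pos (hρ : 0 < ρ) (n : ℕ) : 0 < truncatedGeometric K ρ n :=
  div_pos (pow_pos hρ n) (Finset.sum_pos (fun _ _ => pow_pos hρ _) ⟨0, by simp⟩)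

theorem sum_truncatedGeometric (hρ : 0 < ρ) :
    ∑ n ∈ Finset.range (K + 1), truncatedGeometric K ρ n = 1 := by
  simp only [truncatedGeometric]
  rw [← Finset.sum_div]
  exact div_self (Finset.sum_pos (fun _ _ => pow_pos hρ _) ⟨0, by simp⟩).ne'

theorem mul_truncatedGeometric_succ (hρ : lam = mu * ρ) (n : ℕ) :
    mu * truncatedGeometric K ρ (n + 1) = lam * truncatedGeometric K ρ n := by
  rw [truncatedGeometric, truncatedGeometric, hρ, pow_succ]
  ring

theorem eq_truncatedGeometric_of_vecMul_mm1kGenerator (hmu : mu ≠ 0) (hρ : lam = mu * ρ)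
    {θ : Fin (K + 1) → ℝ} (hθ : θ ᵥ* mm1kGenerator K lam mu = 0) (hsum : ∑ i, θ i = 1) :
    θ = fun i : Fin (K + 1) => truncatedGeometric K ρ i := by
  obtain ⟨T, rfl⟩ : ∃ T : ℕ → ℝ, (fun i : Fin (K + 1) => T i) = θ :=
    Fin.val_injective.surjective_comp_right θ
  have hpow (n : ℕ) (hn : n ≤ K) : T n = T 0 * ρ ^ n := by
    induction n with
    | zero => simp
    | succ n ih =>
      have hbal := detailedBalance_of_vecMul_mm1kGenerator hθ hn
      rw [ih (by omega), hρ] at hbal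
      exact mul_left_cancel₀ hmu (by rw [← hbal]; ring)
  have hT (i : Fin (K + 1)) : T i = T 0 * ρ ^ (i : ℕ) := hpow i (Nat.lt_succ_iff.1 i.2)
  rw [Finset.sum_congr rfl fun i _ => hT i, ← Finset.mul_sum,
    Fin.sum_univ_eq_sum_range fun n => ρ ^ n] at hsum
  funext i
  rw [hT, truncatedGeometric, eq_one_div_of_mul_eq_one_left hsum]
  ring

theorem sum_truncatedGeometric_mul_mm1kGenerator_mulVec (hρ : lam = mu * ρ) (V W : ℕ → ℝ) :
    ∑ i : Fin (K + 1), truncatedGeometric K ρ i * V i *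
        (mm1kGenerator K lam mu *ᵥ fun j => W j) i =
      -(lam * ∑ k ∈ Finset.range K,
        truncatedGeometric K ρ k * ((V (k + 1) - V k) * (W (k + 1) - W k))) := by
  rw [sum_mul_mm1kGenerator_mulVec (fun k => truncatedGeometric K ρ k * V k), Finset.mul_sum,
    ← Finset.sum_neg_distrib]
  refine Finset.sum_congr rfl fun k _ => ?_
  rw [← mul_assoc mu, mul_truncatedGeometric_succ hρ]
  ring

theorem truncatedGeometric_dotProduct_strictLower_mulVec (hρ : lam = mu * ρ)
    (v : Fin (K + 1) → ℝ) :
    (fun i : Fin (K + 1) => truncatedGeometric K ρ i) ⬝ᵥ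
        strictLower (mm1kGenerator K lam mu) *ᵥ v =
      lam * ((fun i : Fin (K + 1) => truncatedGeometric K ρ i) ⬝ᵥ v -
        truncatedGeometric K ρ K * v (Fin.last K)) := by
  obtain ⟨V, rfl⟩ : ∃ V : ℕ → ℝ, (fun i : Fin (K + 1) => V i) = v :=
    Fin.val_injective.surjective_comp_right v
  simp only [dotProduct, strictLower_mm1kGenerator_mulVec, Fin.val_last]
  rw [Fin.sum_univ_eq_sum_range fun i =>
      truncatedGeometric K ρ i * if 0 < i then mu * V (i - 1) else 0,
    Fin.sum_univ_eq_sum_range fun i => truncatedGeometric K ρ i * V i, Finset.sum_range_succ',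
    Finset.sum_range_succ]
  simp only [lt_irrefl, if_false, mul_zero, add_zero, Nat.succ_pos, if_true, Nat.add_sub_cancel,
    add_sub_cancel_right]
  rw [Finset.mul_sum]
  refine Finset.sum_congr rfl fun k _ => ?_
  linear_combination V k * mul_truncatedGeometric_succ (K := K) hρ k

end Generator

section Poincare

theorem sq_sub_le_sum_inv_mul_sum {q : ℕ → ℝ} {K i : ℕ} (hq : ∀ k, 0 < q k) (hi : i ≤ K)
    (U : ℕ → ℝ) :
    (U i - U 0) ^ 2 ≤ (∑ k ∈ Finset.range K, (q k)⁻¹) *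
      ∑ k ∈ Finset.range K, q k * (U (k + 1) - U k) ^ 2 := by
  have hinv (k : ℕ) : 0 ≤ (q k)⁻¹ := (inv_pos.2 (hq k)).le
  have hterm (k : ℕ) : 0 ≤ q k * (U (k + 1) - U k) ^ 2 := mul_nonneg (hq k).le (sq_nonneg _)
  rw [← Finset.sum_range_sub]
  calc (∑ k ∈ Finset.range i, (U (k + 1) - U k)) ^ 2
      ≤ (∑ k ∈ Finset.range i, (q k)⁻¹) *
          ∑ k ∈ Finset.range i, q k * (U (k + 1) - U k) ^ 2 :=
        Finset.sum_sq_le_sum_mul_sum_of_sq_le_mul _ (fun k _ => hinv k) (fun k _ => hterm k)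
          fun k _ => (inv_mul_cancel_left₀ (hq k).ne' _).ge
    _ ≤ _ :=
        mul_le_mul
          (Finset.sum_le_sum_of_subset_of_nonneg (Finset.range_mono hi) fun k _ _ => hinv k)
          (Finset.sum_le_sum_of_subset_of_nonneg (Finset.range_mono hi) fun k _ _ => hterm k)
          (Finset.sum_nonneg fun k _ => hterm k) (Finset.sum_nonneg fun k _ => hinv k)

theorem sum_mul_sq_le_sum_mul_sub_sq {ι : Type*} {s : Finset ι} {p U : ι → ℝ}
    (hp : 0 ≤ ∑ i ∈ s, p i) (hU : ∑ i ∈ s, p i * U i = 0) (a : ℝ) :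
    ∑ i ∈ s, p i * U i ^ 2 ≤ ∑ i ∈ s, p i * (U i - a) ^ 2 := by
  have hexpand : ∑ i ∈ s, p i * (U i - a) ^ 2 =
      ∑ i ∈ s, p i * U i ^ 2 - 2 * a * ∑ i ∈ s, p i * U i + a ^ 2 * ∑ i ∈ s, p i := by
    rw [Finset.mul_sum, Finset.mul_sum, ← Finset.sum_sub_distrib, ← Finset.sum_add_distrib]
    exact Finset.sum_congr rfl fun i _ => by ring
  rw [hexpand, hU, mul_zero, sub_zero]
  exact le_add_of_nonneg_right (mul_nonneg (sq_nonneg a) hp)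

theorem poincare_range {p q : ℕ → ℝ} {K : ℕ} (hp : ∀ i, 0 ≤ p i)
    (hsum : ∑ i ∈ Finset.range (K + 1), p i = 1) (hq : ∀ k, 0 < q k) {U : ℕ → ℝ}
    (hU : ∑ i ∈ Finset.range (K + 1), p i * U i = 0) :
    ∑ i ∈ Finset.range (K + 1), p i * U i ^ 2 ≤ (∑ k ∈ Finset.range K, (q k)⁻¹) *
      ∑ k ∈ Finset.range K, q k * (U (k + 1) - U k) ^ 2 := by
  refine (sum_mul_sq_le_sum_mul_sub_sq (hsum ▸ zero_le_one) hU (U 0)).trans ?_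
  calc ∑ i ∈ Finset.range (K + 1), p i * (U i - U 0) ^ 2
      ≤ ∑ i ∈ Finset.range (K + 1), p i * ((∑ k ∈ Finset.range K, (q k)⁻¹) *
          ∑ k ∈ Finset.range K, q k * (U (k + 1) - U k) ^ 2) :=
        Finset.sum_le_sum fun i hi => mul_le_mul_of_nonneg_left
          (sq_sub_le_sum_inv_mul_sum hq (Nat.lt_succ_iff.1 (Finset.mem_range.1 hi)) U) (hp i)
    _ = _ := by rw [← Finset.sum_mul, hsum, one_mul]

end Poincare

section StationaryCovariance

open scoped Matrix

variable {K : ℕ} {lam mu ρ : ℝ}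

theorem truncatedGeometric_vecMul_mm1kGenerator (hρ : lam = mu * ρ) :
    (fun i : Fin (K + 1) => truncatedGeometric K ρ i) ᵥ* mm1kGenerator K lam mu = 0 := by
  refine dotProduct_eq _ _ fun w => ?_
  obtain ⟨W, rfl⟩ : ∃ W : ℕ → ℝ, (fun i : Fin (K + 1) => W i) = w :=
    Fin.val_injective.surjective_comp_right w
  rw [← Matrix.dotProduct_mulVec, zero_dotProduct]
  simpa [dotProduct] using
    sum_truncatedGeometric_mul_mm1kGenerator_mulVec (K := K) hρ (fun _ => 1) W

theorem exists_spectralGap_mm1kGenerator (hlam : 0 < lam) (hρ0 : 0 < ρ) (hρ : lam = mu * ρ) :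
    ∃ a > 0, ∀ u : Fin (K + 1) → ℝ, (fun i : Fin (K + 1) => truncatedGeometric K ρ i) ⬝ᵥ u = 0 →
      a * ∑ i : Fin (K + 1), truncatedGeometric K ρ i * u i ^ 2 ≤
        -∑ i : Fin (K + 1), truncatedGeometric K ρ i * u i * (mm1kGenerator K lam mu *ᵥ u) i := by
  set π := truncatedGeometric K ρ
  have hπ (n : ℕ) : 0 < π n := truncatedGeometric_pos hρ0 n
  set C := ∑ k ∈ Finset.range K, (π k)⁻¹
  have hC : 0 ≤ C := Finset.sum_nonneg fun k _ => (inv_pos.2 (hπ k)).le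
  refine ⟨lam / (C + 1), by positivity, fun u hu => ?_⟩
  obtain ⟨U, rfl⟩ : ∃ U : ℕ → ℝ, (fun i : Fin (K + 1) => U i) = u :=
    Fin.val_injective.surjective_comp_right u
  rw [dotProduct, Fin.sum_univ_eq_sum_range fun i => π i * U i] at hu
  rw [sum_truncatedGeometric_mul_mm1kGenerator_mulVec hρ,
    Fin.sum_univ_eq_sum_range fun i => π i * U i ^ 2, neg_neg, div_mul_eq_mul_div,
    div_le_iff₀ (by positivity), mul_assoc]
  simp only [← pow_two]
  have hD : 0 ≤ ∑ k ∈ Finset.range K, π k * (U (k + 1) - U k) ^ 2 :=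
    Finset.sum_nonneg fun k _ => mul_nonneg (hπ k).le (sq_nonneg _)
  have hpoincare := poincare_range (fun n => (hπ n).le) (sum_truncatedGeometric hρ0) hπ hu
  exact mul_le_mul_of_nonneg_left (by linarith) hlam.le

theorem tendsto_transitionMatrix_mm1kGenerator_mulVec_apply (hlam : 0 < lam) (hρ0 : 0 < ρ)
    (hρ : lam = mu * ρ) (w : Fin (K + 1) → ℝ) (i : Fin (K + 1)) :
    Tendsto (fun t => (transitionMatrix (mm1kGenerator K lam mu) t *ᵥ w) i) atTop
      (𝓝 ((fun j : Fin (K + 1) => truncatedGeometric K ρ j) ⬝ᵥ w)) := by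
  obtain ⟨a, ha, hgap⟩ := exists_spectralGap_mm1kGenerator (K := K) hlam hρ0 hρ
  refine tendsto_transitionMatrix_mulVec_apply (fun j : Fin (K + 1) => truncatedGeometric_pos hρ0 j)
    ?_ (truncatedGeometric_vecMul_mm1kGenerator hρ) mm1kGenerator_mulVec_one ha hgap w i
  rw [Fin.sum_univ_eq_sum_range, sum_truncatedGeometric hρ0]

theorem departures_eq_downJumpCount {Ω : Type*} (Q : ℝ≥0 → Ω → Fin (K + 1)) (t : ℝ≥0) (ω : Ω) :
    departures Q t ω = downJumpCount (fun s => Q s ω) t :=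
  congrArg Set.ncard <| Set.ext fun _ => and_assoc.symm.trans and_comm

variable {Ω : Type*} [MeasurableSpace Ω] {P : Measure Ω} [IsProbabilityMeasure P]
  {Q : ℝ≥0 → Ω → Fin (K + 1)}

namespace IsStationaryMM1K

theorem law_eq_truncatedGeometric (hQ : IsStationaryMM1K K lam mu P Q) (hmu : mu ≠ 0)
    (hρ : lam = mu * ρ) : law P (Q 0) = fun i : Fin (K + 1) => truncatedGeometric K ρ i := by
  refine eq_truncatedGeometric_of_vecMul_mm1kGenerator hmu hρ hQ.stationary ?_
  have htotal := integral_comp_eq_law_dotProduct (P := P) (hQ.markovChain.measurable 0) 1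
  rw [dotProduct_one] at htotal
  simp [← htotal]

/-- By detailed balance, only the top state `K` contributes to the covariance. -/
theorem covariance_departures (hQ : IsStationaryMM1K K lam mu P Q) (hmu : mu ≠ 0)
    (hρ : lam = mu * ρ) {w : Fin (K + 1) → ℝ} {m : ℝ}
    (hw : ∀ i : Fin (K + 1), (mm1kGenerator K lam mu *ᵥ w) i = m - (i : ℕ)) (t : ℝ≥0) :
    cov[fun ω => (departures Q t ω : ℝ), fun ω => ((Q t ω : ℕ) : ℝ); P] =
      lam * truncatedGeometric K ρ K *
        ((transitionMatrix (mm1kGenerator K lam mu) t *ᵥ w) (Fin.last K) - w (Fin.last K)) := by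
  simp only [departures_eq_downJumpCount]
  rw [hQ.markovChain.covariance_downJumpCount hQ.stationary (f := fun i => ((i : ℕ) : ℝ)) hw,
    hQ.law_eq_truncatedGeometric hmu hρ, truncatedGeometric_dotProduct_strictLower_mulVec hρ,
    dotProduct_sub,
    dotProduct_transitionMatrix_mulVec (truncatedGeometric_vecMul_mm1kGenerator hρ), sub_self,
    Pi.sub_apply]
  ring

theorem tendsto_covariance_departures (hQ : IsStationaryMM1K K lam mu P Q) (hlam : 0 < lam)
    (hρ0 : 0 < ρ) (hρ : lam = mu * ρ) {W : ℕ → ℝ} {m : ℝ}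
    (hW : ∀ i : Fin (K + 1), (mm1kGenerator K lam mu *ᵥ fun j => W j) i = m - (i : ℕ)) :
    Tendsto (fun t : ℝ≥0 => cov[fun ω => (departures Q t ω : ℝ), fun ω => ((Q t ω : ℕ) : ℝ); P])
      atTop (𝓝 (lam * truncatedGeometric K ρ K *
        (∑ n ∈ Finset.range (K + 1), truncatedGeometric K ρ n * W n - W K))) := by
  have hmu : mu ≠ 0 := left_ne_zero_of_mul (hρ ▸ hlam.ne')
  simp only [hQ.covariance_departures hmu hρ hW]
  rw [← Fin.sum_univ_eq_sum_range fun n => truncatedGeometric K ρ n * W n]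
  exact (((tendsto_transitionMatrix_mm1kGenerator_mulVec_apply hlam hρ0 hρ _ _).comp
    (NNReal.tendsto_coe_atTop.2 tendsto_id)).sub_const _).const_mul _

end IsStationaryMM1K

end StationaryCovariance

section PoissonEquation

open scoped Matrix

variable {K : ℕ} {lam mu ρ : ℝ}

/-- The boundary conditions `d 0 = d (K + 1) = 0` on the increments `d` of `W` express reflection
at the ends of `{0, …, K}`. -/
theorem mm1kGenerator_mulVec_of_increments {W d : ℕ → ℝ} (hW : ∀ n, W (n + 1) - W n = d (n + 1))
    (h0 : d 0 = 0) (hK : d (K + 1) = 0) (i : Fin (K + 1)) :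
    (mm1kGenerator K lam mu *ᵥ fun j => W j) i = lam * d (i + 1) - mu * d i := by
  have hup : (if (i : ℕ) < K then lam * (W (i + 1) - W i) else 0) = lam * d (i + 1) := by
    split_ifs with hi
    · rw [hW]
    · rw [show (i : ℕ) = K by omega, hK, mul_zero]
  have hdown : (if 0 < (i : ℕ) then mu * (W (i - 1) - W i) else 0) = -(mu * d i) := by
    rcases (i : ℕ) with _ | n
    · simp [h0]
    · rw [if_pos n.succ_pos, Nat.add_sub_cancel, ← hW]
      ring
  rw [mm1kGenerator_mulVec, hup, hdown, sub_eq_add_neg]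

/-- Solution of the Poisson equation `G W = K / 2 - id` for equal arrival and service rates `r`. -/
noncomputable def criticalPoissonSolution (K : ℕ) (r : ℝ) (n : ℕ) : ℝ :=
  (K * n + (K - 1) * (n * (n - 1) / 2) - n * (n - 1) * (2 * n - 1) / 6) / (2 * r)

theorem mm1kGenerator_mulVec_criticalPoissonSolution (hlam : lam ≠ 0) (i : Fin (K + 1)) :
    (mm1kGenerator K lam lam *ᵥ fun j => criticalPoissonSolution K lam j) i =
      K / 2 - (i : ℕ) := by
  rw [mm1kGenerator_mulVec_of_increments (d := fun n => n * (K + 1 - n) / (2 * lam))]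
  · push_cast
    field_simp
    ring
  · intro n
    simp only [criticalPoissonSolution]
    push_cast
    ring
  · simp
  · simp

/-- Ansatz for the Poisson equation `G W = m - id` when `ρ ≠ 1`: the terms `α n` and `γ / ρ ^ n`
adjust the boundary values of the increments. -/
noncomputable def poissonAnsatz (α β γ ρ : ℝ) (n : ℕ) : ℝ :=
  α * n + β * (n * (n - 1) / 2) + γ / ρ ^ n

theorem mm1kGenerator_mulVec_poissonAnsatz (hρ0 : ρ ≠ 0) (hρ : lam = mu * ρ) {α β γ : ℝ}
    (hβ : (lam - mu) * β = -1) (hα : (ρ ^ (K + 1) - 1) * α = -β * (K * ρ ^ (K + 1) + 1))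
    (hγ : (ρ - 1) * γ = α - β) (i : Fin (K + 1)) :
    (mm1kGenerator K lam mu *ᵥ fun j => poissonAnsatz α β γ ρ j) i =
      (lam - mu) * α + mu * β - (i : ℕ) := by
  rw [mm1kGenerator_mulVec_of_increments (d := fun n => α + β * (n - 1) - (α - β) / ρ ^ n)]
  · have hgeom : lam * ((α - β) / ρ ^ ((i : ℕ) + 1)) = mu * ((α - β) / ρ ^ (i : ℕ)) := by
      rw [hρ, pow_succ]
      field_simp
    push_cast
    linear_combination ((i : ℕ) : ℝ) * hβ - hgeom
  · intro n
    rw [← hγ, poissonAnsatz, poissonAnsatz]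
    push_cast
    field_simp
    ring
  · simp
  · push_cast
    field_simp
    linear_combination hα

end PoissonEquation

section ClosedForm

theorem mul_sum_range_id_mul_pow (r : ℝ) (n : ℕ) :
    (r - 1) ^ 2 * ∑ j ∈ Finset.range (n + 1), (j : ℝ) * r ^ j =
      n * r ^ (n + 2) - (n + 1) * r ^ (n + 1) + r := by
  induction n with
  | zero => simp
  | succ n ih =>
    rw [Finset.sum_range_succ, mul_add, ih]
    push_cast
    ring

theorem mul_sum_range_choose_mul_pow (r : ℝ) (n : ℕ) :
    (r - 1) ^ 3 * ∑ j ∈ Finset.range (n + 1), (j * (j - 1) / 2 : ℝ) * r ^ j =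
      n * (n - 1) / 2 * r ^ (n + 3) - (n ^ 2 - 1) * r ^ (n + 2) +
        n * (n + 1) / 2 * r ^ (n + 1) - r ^ 2 := by
  induction n with
  | zero => simp
  | succ n ih =>
    rw [Finset.sum_range_succ, mul_add, ih]
    push_cast
    ring

variable {K : ℕ} {lam ρ : ℝ}

theorem sum_truncatedGeometric_mul_poissonAnsatz (hρ0 : ρ ≠ 0) (α β γ : ℝ) :
    ∑ n ∈ Finset.range (K + 1), truncatedGeometric K ρ n * poissonAnsatz α β γ ρ n =
      (α * ∑ n ∈ Finset.range (K + 1), (n : ℝ) * ρ ^ n +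
        β * ∑ n ∈ Finset.range (K + 1), (n * (n - 1) / 2 : ℝ) * ρ ^ n + (K + 1) * γ) /
          ∑ n ∈ Finset.range (K + 1), ρ ^ n := by
  have hcard : (K + 1) * γ = ∑ _n ∈ Finset.range (K + 1), γ := by simp
  rw [hcard, Finset.mul_sum, Finset.mul_sum, ← Finset.sum_add_distrib, ← Finset.sum_add_distrib,
    Finset.sum_div]
  refine Finset.sum_congr rfl fun n _ => ?_
  rw [truncatedGeometric, poissonAnsatz]
  field_simp

theorem limit_covariance_of_ne_one (hlam : lam ≠ 0) (hρ0 : 0 < ρ) (hρ1 : ρ ≠ 1) {α β γ : ℝ}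
    (hβ : lam * (ρ - 1) * β = -ρ) (hα : (ρ ^ (K + 1) - 1) * α = -β * (K * ρ ^ (K + 1) + 1))
    (hγ : (ρ - 1) * γ = α - β) :
    lam * truncatedGeometric K ρ K *
        (∑ n ∈ Finset.range (K + 1), truncatedGeometric K ρ n * poissonAnsatz α β γ ρ n -
          poissonAnsatz α β γ ρ K) =
      ρ ^ (K + 1) *
        (((K : ℝ) ^ 2 * (ρ - 1) ^ 2 * (1 + 3 * ρ ^ (K + 1))
            - 2 * ρ * (ρ ^ K - 1) * (-2 + ρ + ρ ^ (K + 2)))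
            / (2 * (ρ - 1) ^ 2 * (ρ ^ (K + 1) - 1) ^ 3)
          + ((K : ℝ) * (ρ - 1) * (-1 + 3 * ρ - 7 * ρ ^ (K + 1) + 5 * ρ ^ (K + 2)))
            / (2 * (ρ - 1) ^ 2 * (ρ ^ (K + 1) - 1) ^ 3)) := by
  have hρ1' : ρ - 1 ≠ 0 := sub_ne_zero.2 hρ1
  have hpow : ρ ^ (K + 1) - 1 ≠ 0 :=
    sub_ne_zero.2 fun h => hρ1 ((pow_eq_one_iff_of_nonneg hρ0.le K.succ_ne_zero).1 h)
  have hX : 0 < ρ ^ K := by positivity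
  rw [sum_truncatedGeometric_mul_poissonAnsatz hρ0.ne', truncatedGeometric, poissonAnsatz,
    geom_sum_eq hρ1, eq_div_of_mul_eq (pow_ne_zero 2 hρ1')
      ((mul_comm _ _).trans (mul_sum_range_id_mul_pow ρ K)),
    eq_div_of_mul_eq (pow_ne_zero 3 hρ1')
      ((mul_comm _ _).trans (mul_sum_range_choose_mul_pow ρ K)),
    eq_div_of_mul_eq hρ1' ((mul_comm _ _).trans hγ),
    eq_div_of_mul_eq hpow ((mul_comm _ _).trans hα),
    eq_div_of_mul_eq (mul_ne_zero hlam hρ1') ((mul_comm _ _).trans hβ)]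
  rw [pow_succ] at hpow
  simp only [pow_add ρ K, pow_one]
  generalize ρ ^ K = X at *
  field_simp
  ring

theorem sum_range_cubic (a b d : ℝ) (n : ℕ) :
    ∑ j ∈ Finset.range (n + 1), (a * j + b * j ^ 2 + d * j ^ 3) =
      a * (n * (n + 1) / 2) + b * (n * (n + 1) * (2 * n + 1) / 6) +
        d * (n * (n + 1) / 2) ^ 2 := by
  induction n with
  | zero => simp
  | succ n ih =>
    rw [Finset.sum_range_succ, ih]
    push_cast
    ring

theorem limit_covariance_of_eq_one (hlam : lam ≠ 0) :
    lam * truncatedGeometric K 1 K *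
        (∑ n ∈ Finset.range (K + 1), truncatedGeometric K 1 n * criticalPoissonSolution K lam n -
          criticalPoissonSolution K lam K) =
      -((K : ℝ) * ((K : ℝ) + 2)) / 24 := by
  have huniform (n : ℕ) : truncatedGeometric K 1 n = 1 / (K + 1) := by simp [truncatedGeometric]
  have hpoly (n : ℕ) : truncatedGeometric K 1 n * criticalPoissonSolution K lam n =
      ((3 * K + 2) / 6 * n + K / 2 * n ^ 2 + -1 / 3 * n ^ 3) / (2 * lam * (K + 1)) := by
    rw [huniform, criticalPoissonSolution]
    field_simp
    ring
  simp only [hpoly]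
  rw [← Finset.sum_div, sum_range_cubic, huniform, criticalPoissonSolution]
  field_simp
  ring

end ClosedForm

section Limit

variable {Ω : Type*} [MeasurableSpace Ω] {P : Measure Ω} [IsProbabilityMeasure P]
  {K : ℕ} {lam mu ρ : ℝ} {Q : ℝ≥0 → Ω → Fin (K + 1)}

namespace IsStationaryMM1K

theorem integrable_departures (hQ : IsStationaryMM1K K lam mu P Q) (t : ℝ≥0) :
    Integrable (fun ω => (departures Q t ω : ℝ)) P := by
  simpa only [departures_eq_downJumpCount] using hQ.markovChain.integrable_downJumpCount t

theorem tendsto_covariance_of_ne_one (hQ : IsStationaryMM1K K lam mu P Q) (hlam : 0 < lam)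
    (hρ0 : 0 < ρ) (hρ : lam = mu * ρ) (hρ1 : ρ ≠ 1) :
    Tendsto (fun t : ℝ≥0 => cov[fun ω => (departures Q t ω : ℝ), fun ω => ((Q t ω : ℕ) : ℝ); P])
      atTop
      (𝓝 (ρ ^ (K + 1) *
        (((K : ℝ) ^ 2 * (ρ - 1) ^ 2 * (1 + 3 * ρ ^ (K + 1))
            - 2 * ρ * (ρ ^ K - 1) * (-2 + ρ + ρ ^ (K + 2)))
            / (2 * (ρ - 1) ^ 2 * (ρ ^ (K + 1) - 1) ^ 3)
          + ((K : ℝ) * (ρ - 1) * (-1 + 3 * ρ - 7 * ρ ^ (K + 1) + 5 * ρ ^ (K + 2)))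
            / (2 * (ρ - 1) ^ 2 * (ρ ^ (K + 1) - 1) ^ 3)))) := by
  have hρ1' : ρ - 1 ≠ 0 := sub_ne_zero.2 hρ1
  have hpow : ρ ^ (K + 1) - 1 ≠ 0 :=
    sub_ne_zero.2 fun h => hρ1 ((pow_eq_one_iff_of_nonneg hρ0.le K.succ_ne_zero).1 h)
  have hdiff : lam - mu ≠ 0 := fun h =>
    mul_ne_zero hlam.ne' hρ1' (by linear_combination ρ * h - hρ)
  obtain ⟨β, hβ⟩ : ∃ β, (lam - mu) * β = -1 := ⟨-1 / (lam - mu), by field_simp⟩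
  obtain ⟨α, hα⟩ : ∃ α, (ρ ^ (K + 1) - 1) * α = -β * (K * ρ ^ (K + 1) + 1) :=
    ⟨-β * (K * ρ ^ (K + 1) + 1) / (ρ ^ (K + 1) - 1), by field_simp⟩
  obtain ⟨γ, hγ⟩ : ∃ γ, (ρ - 1) * γ = α - β := ⟨(α - β) / (ρ - 1), by field_simp⟩
  rw [← limit_covariance_of_ne_one hlam.ne' hρ0 hρ1
    (by linear_combination ρ * hβ - β * hρ) hα hγ]
  exact hQ.tendsto_covariance_departures hlam hρ0 hρ
    (mm1kGenerator_mulVec_poissonAnsatz hρ0.ne' hρ hβ hα hγ)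

theorem tendsto_covariance_of_rates_eq (hQ : IsStationaryMM1K K lam lam P Q) (hlam : 0 < lam) :
    Tendsto (fun t : ℝ≥0 => cov[fun ω => (departures Q t ω : ℝ), fun ω => ((Q t ω : ℕ) : ℝ); P])
      atTop (𝓝 (-((K : ℝ) * ((K : ℝ) + 2)) / 24)) := by
  rw [← limit_covariance_of_eq_one hlam.ne']
  exact hQ.tendsto_covariance_departures hlam one_pos (mul_one lam).symm
    (mm1kGenerator_mulVec_criticalPoissonSolution hlam.ne')

end IsStationaryMM1K

end Limit

theorem mainTheorem8 {Ω : Type*} [MeasurableSpace Ω] (P : Measure Ω) [IsProbabilityMeasure P]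
    (K : ℕ) (lam mu ρ : ℝ) (hlam : 0 < lam) (hmu : 0 < mu) (hρ : ρ = lam / mu)
    (Q : ℝ≥0 → Ω → Fin (K + 1)) (hQ : IsStationaryMM1K K lam mu P Q) :
    (∀ t : ℝ≥0, Integrable (fun ω => (departures Q t ω : ℝ)) P) ∧
    (ρ ≠ 1 →
      Tendsto
        (fun t : ℝ≥0 => cov[fun ω => (departures Q t ω : ℝ), fun ω => ((Q t ω : ℕ) : ℝ); P])
        atTop
        (𝓝 (ρ ^ (K + 1) *
          (((K : ℝ) ^ 2 * (ρ - 1) ^ 2 * (1 + 3 * ρ ^ (K + 1))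
              - 2 * ρ * (ρ ^ K - 1) * (-2 + ρ + ρ ^ (K + 2)))
              / (2 * (ρ - 1) ^ 2 * (ρ ^ (K + 1) - 1) ^ 3)
            + ((K : ℝ) * (ρ - 1) * (-1 + 3 * ρ - 7 * ρ ^ (K + 1) + 5 * ρ ^ (K + 2)))
              / (2 * (ρ - 1) ^ 2 * (ρ ^ (K + 1) - 1) ^ 3))))) ∧
    (ρ = 1 →
      Tendsto
        (fun t : ℝ≥0 => cov[fun ω => (departures Q t ω : ℝ), fun ω => ((Q t ω : ℕ) : ℝ); P])
        atTop
        (𝓝 (-((K : ℝ) * ((K : ℝ) + 2)) / 24))) := by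
  have hρ0 : 0 < ρ := hρ ▸ div_pos hlam hmu
  have hlam_eq : lam = mu * ρ := by rw [hρ, mul_div_cancel₀ _ hmu.ne']
  refine ⟨hQ.integrable_departures, hQ.tendsto_covariance_of_ne_one hlam hρ0 hlam_eq, fun h1 => ?_⟩
  obtain rfl : lam = mu := by rw [hlam_eq, h1, mul_one]
  exact hQ.tendsto_covariance_of_rates_eq hlam
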